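/- All rings are associative with a non-zero identity element. A ring $R$ is centrally essential if for every non-zero $a\in R$ there are non-zero central elements $x,y$ of $R$ with $ax=y$; $R$ is completely centrally essential if every (non-zero) factor ring of $R$ is centrally essential. Put $[a,b]=ab-ba$. Let $R^{[1]}=R$ and let $R^{[i+1]}$ be the additive subgroup generated by all $[a,b]$ with $a\in R^{[i]}$, $b\in R$; $R$ is Lie nilpotent if $R^{[n+1]}=0$ for some positive integer $n$, and the least such $n$ is its Lie nilpotence class. Let $R^{(1)}=R$ and let $R^{(i+1)}$ be the two-sided ideal generated by all $[a,b]$ with $a\in R^{(i)}$, $b\in R$; $R$ is strongly Lie nilpotent if $R^{(m)}=0$ for some positive integer $m$. A finite central series of $R$ is a chain of two-sided ideals $0=J_0\subseteq J_1\subseteq\dots\subseteq J_m=R$ with $[a,b]\in J_i$ for all $0\le i<m$, $a\in J_{i+1}$, $b\in R$. A PI-ring is a ring in which some polynomial over $\mathbb{Z}$ in non-commuting variables, one of whose monomials of highest degree has coefficient $1$, vanishes identically. **Theorem 1.4.** Let $R$ be a completely centrally essential ring. (1) If $R$ is semiprimary, i.e. its Jacobson radical $J(R)$ is nilpotent and $R/J(R)$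 is semisimple artinian, and if $J(R)^n=0$, then $R$ is Lie nilpotent and its Lie nilpotence class is at most $n$. (2) If $R$ is (left and right) noetherian, then $R$ is strongly Lie nilpotent and has a finite central series; in particular, $R$ is a PI-ring. -/

import Mathlib

/-- A ring is centrally essential if every non-zero `a` has non-zero central `x`, `y` with
`a * x = y`. -/
def IsCentrallyEssential (R : Type*) [Ring R] : Prop :=
  ∀ a : R, a ≠ 0 → ∃ x ∈ Subring.center R, ∃ y ∈ Subring.center R, x ≠ 0 ∧ y ≠ 0 ∧ a * x = y

/-- Every factor ring (by a two-sided ideal) is centrally essential. The zero factor ring `R ⧸ ⊤`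
satisfies the condition vacuously. -/
def IsCompletelyCentrallyEssential (R : Type*) [Ring R] : Prop :=
  ∀ (I : Ideal R) [I.IsTwoSided], IsCentrallyEssential (R ⧸ I)

/-- The Lie powers of `R`, with the index starting at `0`: `lieSeries R k` is `R^[k+1]`, where
`R^[1] = R` and `R^[i+1]` is the additive subgroup generated by all `a * b - b * a` with
`a ∈ R^[i]` and `b ∈ R`. -/
def lieSeries (R : Type*) [Ring R] : ℕ → AddSubgroup R
  | 0 => ⊤
  | k + 1 => AddSubgroup.closure {z | ∃ a ∈ lieSeries R k, ∃ b : R, z = a * b - b * a}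

/-- `R^[n+1] = 0` for some positive integer `n`. -/
def IsLieNilpotent (R : Type*) [Ring R] : Prop :=
  ∃ n : ℕ, 0 < n ∧ lieSeries R n = ⊥

/-- The least positive integer `n` with `R^[n+1] = 0` (meaningful when `R` is Lie nilpotent). -/
noncomputable def lieNilpotenceClass (R : Type*) [Ring R] : ℕ :=
  sInf {n : ℕ | 0 < n ∧ lieSeries R n = ⊥}

/-- The strong Lie powers of `R`, with the index starting at `0`: `strongLieSeries R k` is
`R^(k+1)`, where `R^(1) = R` and `R^(i+1)` is the two-sided ideal generated by all
`a * b - b * a` with `a ∈ R^(i)` and `b ∈ R`. -/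
def strongLieSeries (R : Type*) [Ring R] : ℕ → TwoSidedIdeal R
  | 0 => ⊤
  | k + 1 => TwoSidedIdeal.span {z | ∃ a ∈ strongLieSeries R k, ∃ b : R, z = a * b - b * a}

/-- `R^(m) = 0` for some positive integer `m`. -/
def IsStronglyLieNilpotent (R : Type*) [Ring R] : Prop :=
  ∃ k : ℕ, strongLieSeries R k = ⊥

/-- There is a finite chain `0 = J 0 ⊆ J 1 ⊆ ⋯ ⊆ J m = R` of two-sided ideals in which every
factor `J (i+1) / J i` is central, that is, `[J (i+1), R] ⊆ J i`. -/
def HasFiniteCentralSeries (R : Type*) [Ring R] : Prop :=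
  ∃ (m : ℕ) (J : ℕ → TwoSidedIdeal R), J 0 = ⊥ ∧ J m = ⊤ ∧
    ∀ i < m, J i ≤ J (i + 1) ∧ ∀ a ∈ J (i + 1), ∀ b : R, a * b - b * a ∈ J i

/-- A PI-ring: some polynomial with integer coefficients in non-commuting variables, one of whose
monomials of highest degree has coefficient `1`, vanishes under all substitutions of elements of
the ring for the variables. -/
def IsPIRing (R : Type*) [Ring R] : Prop :=
  ∃ f : FreeAlgebra ℤ ℕ,
    (∃ w : FreeMonoid ℕ,
      (FreeAlgebra.equivMonoidAlgebraFreeMonoid f).coeff w = 1 ∧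
      ∀ v : FreeMonoid ℕ, (FreeAlgebra.equivMonoidAlgebraFreeMonoid f).coeff v ≠ 0 →
        v.length ≤ w.length) ∧
    ∀ s : ℕ → R, FreeAlgebra.lift ℤ s f = 0

/-! Both parts first make R commutative modulo a nilpotent ideal, using
`mul_comm_of_center_reduced`. Semiprimary case: R/J is commutative. In R/J^(k+1), an element of J^k
kills the radical on its right, so `central_of_mul_ker_eq_zero` makes it central. Hence [J^k, R] ⊆
J^(k+1). Noetherian case: a maximal nilpotent ideal N contains all commutators. For proper I, some
element of a power of N has a non-zero central multiple y in R/I that kills commutators. The ideal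
generated by y in R/I is then central, and noetherian induction on I, ending at I = 0, bounds the
strong Lie series. -/

/-! ### Central elements in centrally essential rings. -/

section CentrallyEssential

variable {R : Type*} [Ring R]

/-- The definition of centrally essential rings with the central elements unfolded. -/
theorem IsCentrallyEssential.exists_commute (hR : IsCentrallyEssential R) {a : R} (ha : a ≠ 0) :
    ∃ x : R, (∀ r, r * x = x * r) ∧ a * x ≠ 0 ∧ ∀ r, r * (a * x) = a * x * r := by
  obtain ⟨x, hx, y, hy, -, hy0, rfl⟩ := hR a ha
  exact ⟨x, Subring.mem_center_iff.1 hx, hy0, Subring.mem_center_iff.1 hy⟩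

/-- Idempotents of a centrally essential ring are central. -/
theorem IsCentrallyEssential.idempotent_central (hR : IsCentrallyEssential R) {e : R}
    (he : e * e = e) (r : R) : r * e = e * r := by
  -- A non-zero central multiple y of this element would satisfy y = f y = y f = 0.
  have key : ∀ f : R, f * f = f → ∀ s, f * s * (1 - f) = 0 := by
    intro f hf s
    by_contra h
    obtain ⟨x, hx, h0, hy⟩ := hR.exists_commute h
    apply h0
    calc f * s * (1 - f) * x = f * (f * s * (1 - f) * x) := by
          simp only [← mul_assoc, hf]
      _ = f * s * (1 - f) * x * f := hy f
      _ = f * s * ((1 - f) * (x * f)) := by simp only [mul_assoc]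
      _ = f * s * ((1 - f) * (f * x)) := by rw [hx f]
      _ = 0 := by rw [← mul_assoc (1 - f), sub_mul, hf]; simp
  have h1 := key e he r
  have h2 := key (1 - e) (by simp only [mul_sub, sub_mul, he]; simp) r
  simp only [mul_sub, sub_mul, mul_one, one_mul, sub_sub_cancel, sub_eq_zero] at h1 h2
  rw [h1, h2]

/-- A centrally essential ring without non-zero central elements of square zero is commutative. -/
theorem IsCentrallyEssential.mul_comm_of_center_reduced (hR : IsCentrallyEssential R)
    (hred : ∀ z : R, (∀ r, r * z = z * r) → z * z = 0 → z = 0) (a b : R) : a * b = b * a := by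
  by_contra hab
  have hc : a * b - b * a ≠ 0 := sub_ne_zero.2 hab
  obtain ⟨x, hx, hy0, hy⟩ := hR.exists_commute hc
  set c := a * b - b * a with hcdef
  set y := c * x with hydef
  -- For central z, the commutator of `a * z` with `b` is `c * z`.
  have hcomm : ∀ z : R, (∀ r, r * z = z * r) → (∀ r, r * (a * z) = a * z * r) → c * z = 0 := by
    intro z hz haz
    have := haz b
    rw [hcdef, sub_mul, sub_eq_zero, mul_assoc, hz b, ← mul_assoc, ← this, mul_assoc]
  have hay : a * y ≠ 0 := by
    intro h
    have hcy : c * y = 0 := hcomm y hy (by simp [h])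
    refine hy0 (hred y hy ?_)
    calc y * y = c * (x * y) := mul_assoc c x y
      _ = c * y * x := by rw [mul_assoc, hx y]
      _ = 0 := by rw [hcy, zero_mul]
  obtain ⟨x', hx', h0, hz⟩ := hR.exists_commute hay
  have hyx : ∀ r, r * (y * x') = y * x' * r := fun r ↦
    (Commute.mul_right (hy r) (hx' r)).eq
  have hcz : c * (y * x') = 0 := hcomm _ hyx (by simpa only [mul_assoc] using hz)
  have : y * x' = 0 := by
    refine hred _ hyx ?_
    calc y * x' * (y * x') = c * (x * (y * x')) * x' := by
          rw [hydef]; simp only [mul_assoc]; rw [← hx' (c * (x * x'))]; simp only [mul_assoc]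
      _ = c * (y * x') * x * x' := by rw [← hx (y * x')]; simp only [mul_assoc]
      _ = 0 := by rw [hcz]; simp
  exact h0 (by rw [mul_assoc, this, mul_zero])

/-- If commutators lie in a nilpotent ideal, then every non-zero centrally essential factor ring
has a non-zero central element that annihilates all commutators. -/
theorem IsCentrallyEssential.exists_central_annihilating_commutators (I : Ideal R) [I.IsTwoSided]
    (hI : I ≠ ⊤) (hR : IsCentrallyEssential (R ⧸ I)) (N : Ideal R) [N.IsTwoSided]
    (hN : IsNilpotent N) (hcomm : ∀ a b : R, a * b - b * a ∈ N) :
    ∃ y : R ⧸ I, y ≠ 0 ∧ (∀ r, r * y = y * r) ∧ ∀ a b, y * (a * b - b * a) = 0 := by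
  classical
  have hex : ∃ n, N ^ n ≤ I := hN.imp fun n hn ↦ hn.le.trans bot_le
  obtain ⟨k, hk⟩ : ∃ k, Nat.find hex = k + 1 := by
    refine Nat.exists_eq_succ_of_ne_zero fun h ↦ hI (top_le_iff.1 ?_)
    have := Nat.find_spec hex
    rwa [h, Submodule.pow_zero, Ideal.one_eq_top] at this
  have hle : N ^ (k + 1) ≤ I := hk ▸ Nat.find_spec hex
  -- Minimality of the exponent puts `a` in N^k outside I, while `a` times any commutator falls into
  -- N^(k+1) ≤ I.
  obtain ⟨a, ha, haI⟩ := SetLike.not_le_iff_exists.1 (Nat.find_min hex (m := k) (by omega))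
  obtain ⟨x, hx, h0, hy⟩ := hR.exists_commute (mt Ideal.Quotient.eq_zero_iff_mem.1 haI)
  refine ⟨_, h0, hy, fun b c ↦ ?_⟩
  obtain ⟨b, rfl⟩ := Ideal.Quotient.mk_surjective b
  obtain ⟨c, rfl⟩ := Ideal.Quotient.mk_surjective c
  obtain ⟨x, rfl⟩ := Ideal.Quotient.mk_surjective x
  simp only [← map_mul, ← map_sub]
  refine Ideal.Quotient.eq_zero_iff_mem.2 (hle ?_)
  rw [Submodule.pow_succ]
  exact Ideal.mul_mem_mul (Ideal.mul_mem_right _ _ ha) (hcomm b c)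

/-- An element annihilating a nil kernel of a surjection from a centrally essential ring onto a
commutative semisimple ring is central. -/
theorem IsCentrallyEssential.central_of_mul_ker_eq_zero {F : Type*} [Ring F] [IsSemisimpleRing F]
    (hR : IsCentrallyEssential R) (hF : ∀ x y : F, x * y = y * x) (f : R →+* F)
    (hf : Function.Surjective f) (hker : ∀ x ∈ RingHom.ker f, IsNilpotent x) {a : R}
    (ha : ∀ x ∈ RingHom.ker f, a * x = 0) (r : R) : r * a = a * r := by
  have step : ∀ a : R, a ≠ 0 → (∀ x ∈ RingHom.ker f, a * x = 0) →
      ∃ e : R, e * e = e ∧ a * e ≠ 0 ∧ ∀ r, r * (a * e) = a * e * r := by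
    intro a ha0 ha
    obtain ⟨x, hx, h0, hy⟩ := hR.exists_commute ha0
    obtain ⟨e', he', hspan⟩ := IsSemisimpleRing.ideal_eq_span_idempotent (Ideal.span {f x})
    obtain ⟨e, he, rfl⟩ := exists_isIdempotentElem_eq_of_ker_isNilpotent f hker e'
      (RingHom.mem_range.2 (hf e')) he'
    have hec := hR.idempotent_central he
    obtain ⟨s, hs⟩ := Ideal.mem_span_singleton'.1
      (hspan ▸ Ideal.mem_span_singleton_self (f e) : f e ∈ Ideal.span {f x})
    obtain ⟨t, ht⟩ := Ideal.mem_span_singleton'.1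
      (hspan ▸ Ideal.mem_span_singleton_self (f x) : f x ∈ Ideal.span {f e})
    have hxe : a * (x * e) = a * x := by
      have : a * (x - x * e) = 0 := by
        apply ha
        rw [RingHom.mem_ker, map_sub, map_mul, ← ht, mul_assoc, he'.eq, sub_self]
      rwa [mul_sub, sub_eq_zero, eq_comm] at this
    -- Since `a` kills the kernel, `a * x` sees only the part of `x` under `e`. There `x` is
    -- invertible modulo the kernel, so `u` is a central unit and a e = a x u⁻¹ is central.
    set u := x * e + (1 - e) with hu
    have hue : u * e = x * e := by
      rw [hu, add_mul, sub_mul, mul_assoc, he.eq, one_mul, sub_self, add_zero]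
    have huc : ∀ r, r * u = u * r := fun r ↦
      ((Commute.mul_right (hx r) (hec r)).add_right
        ((Commute.one_right r).sub_right (hec r))).eq
    -- A lift of the inverse of `f u`; `w` below corrects it by a unit, the kernel being nil.
    obtain ⟨v, hv⟩ := hf (s * f e + (1 - f e))
    have hfuv : f (u * v) = 1 := by
      have h1 : f x * f e * (s * f e) = f e := by
        rw [hF (f x), mul_assoc, ← mul_assoc (f x), hF (f x) s, hs, he'.eq, he'.eq]
      have h2 : f x * f e * (1 - f e) = 0 := by
        rw [mul_assoc, mul_sub, mul_one, he'.eq, sub_self, mul_zero]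
      have h3 : (1 - f e) * (s * f e) = 0 := by
        rw [hF s, ← mul_assoc, sub_mul, one_mul, he'.eq, sub_self, zero_mul]
      have h4 : (1 - f e) * (1 - f e) = 1 - f e := he'.one_sub.eq
      rw [map_mul, hv, hu, map_add, map_mul, map_sub, map_one, mul_add, add_mul, add_mul, h1, h2,
        h3, h4]
      abel
    have huvu : IsUnit (u * v) := by
      have := (hker (u * v - 1) (by simp [RingHom.mem_ker, hfuv])).isUnit_add_one
      simpa using this
    obtain ⟨w, hw⟩ := huvu.exists_right_inv
    have huw : u * (v * w) = 1 := by rw [← mul_assoc, hw]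
    have hae : a * x * (v * w) = a * e := by
      rw [← hxe, ← hue, ← huc, mul_assoc, mul_assoc, huw, mul_one]
    have hwc : ∀ r, r * (v * w) = v * w * r := fun r ↦ by
      calc r * (v * w) = (u * (v * w)) * (r * (v * w)) := by rw [huw, one_mul]
        _ = (v * w) * (u * (r * (v * w))) := by rw [← huc (v * w), mul_assoc (v * w)]
        _ = (v * w) * (r * (u * (v * w))) := by rw [← mul_assoc u, ← huc r, mul_assoc r]
        _ = v * w * r := by rw [huw, mul_one]
    refine ⟨e, he, fun h ↦ ?_, fun r ↦ ?_⟩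
    · rw [← hxe, hec, ← mul_assoc, h, zero_mul] at h0
      exact h0 rfl
    · rw [← hae, ← mul_assoc, hy, mul_assoc, hwc, mul_assoc (a * x)]
  -- Choose `e` with `a * e` central and the ideal of `f e` maximal. If `a * (1 - e)` were non-zero,
  -- `step` would give an idempotent `e'` for it, and e + (1 - e) e' would contradict maximality.
  let S : Set (Ideal F) := {I | ∃ e : R, e * e = e ∧ (∀ r, r * (a * e) = a * e * r) ∧
    I = Ideal.span {f e}}
  have hS : S.Nonempty := ⟨_, 0, by simp, by simp, rfl⟩
  obtain ⟨I, ⟨e, he, hae, rfl⟩, hmax⟩ := set_has_maximal_iff_noetherian.2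
    (inferInstanceAs (IsNoetherian F F)) S hS
  have hec := hR.idempotent_central he
  have h0 : a * (1 - e) = 0 := by
    by_contra h
    obtain ⟨e', he', hne, hc⟩ := step (a * (1 - e)) h fun x hx ↦ by
      rw [mul_assoc]; exact ha _ (Ideal.mul_mem_left _ _ hx)
    have hec' := hR.idempotent_central he'
    have hp : (1 - e) * e' * ((1 - e) * e') = (1 - e) * e' :=
      (IsIdempotentElem.mul_of_commute (hec' _) (IsIdempotentElem.one_sub he) he').eq
    have hpe : (1 - e) * e' * e = 0 := by
      rw [mul_assoc, ← hec', ← mul_assoc, sub_mul, he]; simp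
    have heg : e * (e + (1 - e) * e') = e := by
      rw [mul_add, ← mul_assoc, mul_sub, he]; simp
    have hlt := hmax (Ideal.span {f (e + (1 - e) * e')}) ⟨e + (1 - e) * e', by
        rw [add_mul, heg, mul_add, hpe, hp, zero_add], fun r ↦ by
        rw [mul_add, mul_add, add_mul, hae, ← mul_assoc a, hc], rfl⟩
    have hle : Ideal.span {f e} ≤ Ideal.span {f (e + (1 - e) * e')} := by
      rw [Ideal.span_singleton_le_iff_mem, Ideal.mem_span_singleton']
      exact ⟨f e, by rw [← map_mul, heg]⟩
    have hge := not_lt_iff_le_imp_ge.1 hlt hle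
    rw [Ideal.span_singleton_le_iff_mem, Ideal.mem_span_singleton'] at hge
    obtain ⟨t, ht⟩ := hge
    have hk : (1 - e) * e' ∈ RingHom.ker f := by
      have h1 : (e + (1 - e) * e') * (1 - e) = (1 - e) * e' := by
        rw [add_mul, mul_assoc, ← hec', ← mul_assoc, mul_sub e, sub_mul 1 e (1 - e), mul_sub e, he]
        simp
      have h2 : f e * (1 - f e) = 0 := by rw [← map_one f, ← map_sub, ← map_mul, mul_sub, he]; simp
      rw [RingHom.mem_ker, ← h1, map_mul, ← ht, map_sub, map_one, mul_assoc, h2, mul_zero]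
    exact hne (by rw [mul_assoc, ha _ hk])
  rw [mul_sub, mul_one, sub_eq_zero] at h0
  rw [h0, hae]

end CentrallyEssential
-- Noetherian completely centrally essential rings.
section CompletelyCentrallyEssential

variable {R : Type*} [Ring R]

/-- A noetherian completely centrally essential ring is commutative modulo a nilpotent ideal. -/
theorem IsCompletelyCentrallyEssential.exists_nilpotent_ideal [IsNoetherianRing R]
    (hR : IsCompletelyCentrallyEssential R) :
    ∃ N : Ideal R, N.IsTwoSided ∧ IsNilpotent N ∧ ∀ a b : R, a * b - b * a ∈ N := by
  let S : Set (Ideal R) := {N | N.IsTwoSided ∧ IsNilpotent N}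
  have hS : S.Nonempty := ⟨⊥, inferInstance, 1, by rw [Submodule.pow_one]; rfl⟩
  obtain ⟨N, ⟨h2, n, hn⟩, hmax⟩ := set_has_maximal_iff_noetherian.2
    (inferInstanceAs (IsNoetherian R R)) S hS
  refine ⟨N, h2, ⟨n, hn⟩, fun a b ↦ ?_⟩
  rw [← Ideal.Quotient.eq, map_mul, map_mul]
  refine (hR N).mul_comm_of_center_reduced (fun z hz hzz ↦ ?_) _ _
  have hz2 : (Ideal.span {z}).IsTwoSided := ⟨fun {c} d hc ↦ by
    obtain ⟨r, rfl⟩ := Ideal.mem_span_singleton'.1 hc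
    rw [mul_assoc, ← hz, ← mul_assoc]
    exact Ideal.mul_mem_left _ _ (Ideal.mem_span_singleton_self z)⟩
  let M : Ideal R := (Ideal.span {z}).comap (Ideal.Quotient.mk N)
  have hNM : N ≤ M := fun x hx ↦ by
    rw [Ideal.mem_comap, Ideal.Quotient.eq_zero_iff_mem.2 hx]; exact zero_mem _
  -- A central element of square zero modulo N generates an ideal of square zero there.
  have hMM : M * M ≤ N := by
    rw [Ideal.mul_le]
    intro r hr s hs
    obtain ⟨p, hp⟩ := Ideal.mem_span_singleton'.1 (Ideal.mem_comap.1 hr)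
    obtain ⟨q, hq⟩ := Ideal.mem_span_singleton'.1 (Ideal.mem_comap.1 hs)
    rw [← Ideal.Quotient.eq_zero_iff_mem, map_mul, ← hp, ← hq, mul_assoc, ← mul_assoc z, ← hz q,
      mul_assoc, hzz, mul_zero, mul_zero]
  have hMnil : IsNilpotent M := by
    refine ⟨2 * n, le_bot_iff.1 ?_⟩
    have : ∀ k, M ^ (2 * k) ≤ N ^ k := by
      intro k
      induction k with
      | zero => rw [mul_zero, Submodule.pow_zero, Submodule.pow_zero]
      | succ k ih =>
        rw [Nat.mul_succ, Ideal.IsTwoSided.pow_add, Submodule.pow_succ (M := N)]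
        refine Ideal.mul_mono ih ?_
        rwa [Submodule.pow_succ, Submodule.pow_one]
    exact (this n).trans hn.le
  have hMN : M ≤ N := not_lt_iff_le_imp_ge.1 (hmax M ⟨inferInstance, hMnil⟩) hNM
  obtain ⟨x, rfl⟩ := Ideal.Quotient.mk_surjective z
  exact Ideal.Quotient.eq_zero_iff_mem.2
    (hMN (Ideal.mem_comap.2 (Ideal.mem_span_singleton_self _)))

/-- Every two-sided ideal of a noetherian completely centrally essential ring contains a term of the
strong Lie series. -/
theorem IsCompletelyCentrallyEssential.exists_strongLieSeries_le [IsNoetherianRing R]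
    (hR : IsCompletelyCentrallyEssential R) (I : Ideal R) (hI : I.IsTwoSided) :
    ∃ k, ∀ x ∈ strongLieSeries R k, x ∈ I := by
  obtain ⟨N, hN2, hN, hcomm⟩ := hR.exists_nilpotent_ideal
  revert hI
  refine IsNoetherian.induction (R := R) (M := R)
    (P := fun I : Ideal R ↦ I.IsTwoSided → ∃ k, ∀ x ∈ strongLieSeries R k, x ∈ I) ?_ I
  intro I ih hI
  by_cases htop : I = ⊤
  · exact ⟨0, fun x _ ↦ htop ▸ Submodule.mem_top⟩
  obtain ⟨y, hy0, hy, hyc⟩ := IsCentrallyEssential.exists_central_annihilating_commutators I htop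
    (hR I) N hN hcomm
  have hy2 : (Ideal.span {y}).IsTwoSided := ⟨fun {c} d hc ↦ by
    obtain ⟨r, rfl⟩ := Ideal.mem_span_singleton'.1 hc
    rw [mul_assoc, ← hy, ← mul_assoc]
    exact Ideal.mul_mem_left _ _ (Ideal.mem_span_singleton_self y)⟩
  let K : Ideal R := (Ideal.span {y}).comap (Ideal.Quotient.mk I)
  have hIK : I < K := by
    refine lt_of_le_of_ne (fun x hx ↦ ?_) fun h ↦ hy0 ?_
    · rw [Ideal.mem_comap, Ideal.Quotient.eq_zero_iff_mem.2 hx]; exact zero_mem _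
    · obtain ⟨x, rfl⟩ := Ideal.Quotient.mk_surjective y
      have hx : x ∈ K := Ideal.mem_comap.2 (Ideal.mem_span_singleton_self _)
      exact Ideal.Quotient.eq_zero_iff_mem.2 (h ▸ hx)
  obtain ⟨k, hk⟩ := ih K hIK inferInstance
  refine ⟨k + 1, fun x hx ↦ ?_⟩
  -- Modulo I, elements of K have the form r y, and r y b = y r b = y b r = b r y modulo I, so K / I
  -- is central.
  have hle : strongLieSeries R (k + 1) ≤ Ideal.toTwoSided I := by
    refine TwoSidedIdeal.span_le.2 ?_
    rintro _ ⟨a, ha, b, rfl⟩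
    rw [SetLike.mem_coe, Ideal.mem_toTwoSided, ← Ideal.Quotient.eq, map_mul, map_mul]
    obtain ⟨r, hr⟩ := Ideal.mem_span_singleton'.1 (Ideal.mem_comap.1 (hk a ha))
    have := hyc r (Ideal.Quotient.mk I b)
    rw [mul_sub, sub_eq_zero] at this
    rw [← hr, hy r, mul_assoc, this, ← mul_assoc, ← mul_assoc, hy (Ideal.Quotient.mk I b)]
  exact Ideal.mem_toTwoSided.1 (hle hx)

end CompletelyCentrallyEssential

/-! ### Central series and polynomial identities from strong Lie nilpotence. -/

section LieSeries

variable {R : Type*} [Ring R]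

theorem strongLieSeries_commutator_mem {k : ℕ} {a : R} (ha : a ∈ strongLieSeries R k) (b : R) :
    a * b - b * a ∈ strongLieSeries R (k + 1) :=
  TwoSidedIdeal.subset_span ⟨a, ha, b, rfl⟩

theorem strongLieSeries_succ_le (k : ℕ) : strongLieSeries R (k + 1) ≤ strongLieSeries R k := by
  refine TwoSidedIdeal.span_le.2 ?_
  rintro _ ⟨a, ha, b, rfl⟩
  exact sub_mem (TwoSidedIdeal.mul_mem_right _ _ _ ha) (TwoSidedIdeal.mul_mem_left _ _ _ ha)

/-- The strong Lie series read backwards is a central series. -/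
theorem IsStronglyLieNilpotent.hasFiniteCentralSeries (h : IsStronglyLieNilpotent R) :
    HasFiniteCentralSeries R := by
  obtain ⟨k, hk⟩ := h
  refine ⟨k, fun i ↦ strongLieSeries R (k - i), hk, by simp only [Nat.sub_self]; rfl, fun i hi ↦ ?_⟩
  obtain ⟨j, hj⟩ : ∃ j, k - i = j + 1 := ⟨k - i - 1, by omega⟩
  have hj' : k - (i + 1) = j := by omega
  simp only [hj, hj']
  exact ⟨strongLieSeries_succ_le j, fun a ha b ↦ strongLieSeries_commutator_mem ha b⟩

/-- The left-normed commutator `[[x₀, x₁], …, xₖ]`. -/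
noncomputable def leftNormedCommutator : ℕ → FreeAlgebra ℤ ℕ
  | 0 => FreeAlgebra.ι ℤ 0
  | k + 1 => leftNormedCommutator k * FreeAlgebra.ι ℤ (k + 1) -
      FreeAlgebra.ι ℤ (k + 1) * leftNormedCommutator k

theorem lift_leftNormedCommutator_mem (s : ℕ → R) (k : ℕ) :
    FreeAlgebra.lift ℤ s (leftNormedCommutator k) ∈ strongLieSeries R k := by
  induction k with
  | zero => exact trivial
  | succ k ih =>
    simp only [leftNormedCommutator, map_sub, map_mul, FreeAlgebra.lift_ι_apply]
    exact strongLieSeries_commutator_mem ih _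

/-- The monomial `x₀ x₁ ⋯ xₖ`. -/
def ascendingMonomial : ℕ → FreeMonoid ℕ
  | 0 => FreeMonoid.of 0
  | k + 1 => ascendingMonomial k * FreeMonoid.of (k + 1)

theorem length_ascendingMonomial (k : ℕ) : (ascendingMonomial k).length = k + 1 := by
  induction k with
  | zero => rfl
  | succ k ih => rw [ascendingMonomial, FreeMonoid.length_mul, ih, FreeMonoid.length_of]

theorem head?_ascendingMonomial (k : ℕ) : (ascendingMonomial k).toList.head? = some 0 := by
  induction k with
  | zero => rfl
  | succ k ih => rw [ascendingMonomial, FreeMonoid.toList_mul, List.head?_append, ih]; rfl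

open FreeAlgebra in
theorem equivMonoidAlgebraFreeMonoid_ι (n : ℕ) :
    equivMonoidAlgebraFreeMonoid (ι ℤ n) = MonoidAlgebra.single (FreeMonoid.of n) (1 : ℤ) := by
  simp [equivMonoidAlgebraFreeMonoid]

open FreeAlgebra in
-- The ascending monomial starts with x₀, whereas every word of the subtracted product starts with
-- the newest variable; only the first product contributes.
theorem coeff_leftNormedCommutator_ascendingMonomial (k : ℕ) :
    (equivMonoidAlgebraFreeMonoid (leftNormedCommutator k)).coeff (ascendingMonomial k) = 1 := by
  induction k with
  | zero => simp [leftNormedCommutator, ascendingMonomial, equivMonoidAlgebraFreeMonoid_ι]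
  | succ k ih =>
    have hne : ∀ d, FreeMonoid.of (k + 1) * d ≠ ascendingMonomial (k + 1) := by
      intro d h
      have := head?_ascendingMonomial (k + 1)
      rw [← h, FreeMonoid.toList_of_mul, List.head?_cons] at this
      simp at this
    rw [leftNormedCommutator, map_sub, map_mul, map_mul, equivMonoidAlgebraFreeMonoid_ι,
      MonoidAlgebra.coeff_sub, Finsupp.sub_apply,
      MonoidAlgebra.coeff_single_mul_of_forall_mul_ne _ _ hne, ascendingMonomial,
      MonoidAlgebra.coeff_mul_single_mul, ih, mul_one, sub_zero]

open FreeAlgebra in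
theorem length_le_of_coeff_leftNormedCommutator_ne_zero (k : ℕ) (v : FreeMonoid ℕ)
    (hv : (equivMonoidAlgebraFreeMonoid (leftNormedCommutator k)).coeff v ≠ 0) :
    v.length ≤ k + 1 := by
  induction k generalizing v with
  | zero =>
    by_contra h
    refine hv ?_
    rw [leftNormedCommutator, equivMonoidAlgebraFreeMonoid_ι, MonoidAlgebra.coeff_single,
      Finsupp.single_eq_of_ne]
    rintro rfl
    exact h (by rw [FreeMonoid.length_of])
  | succ k ih =>
    by_contra h
    refine hv ?_
    rw [leftNormedCommutator, map_sub, map_mul, map_mul, equivMonoidAlgebraFreeMonoid_ι,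
      MonoidAlgebra.coeff_sub, Finsupp.sub_apply, sub_eq_zero]
    trans 0
    · by_cases hd : ∃ d, d * FreeMonoid.of (k + 1) = v
      · obtain ⟨d, rfl⟩ := hd
        rw [MonoidAlgebra.coeff_mul_single_mul, mul_one]
        by_contra hd
        have := ih d hd
        rw [FreeMonoid.length_mul, FreeMonoid.length_of] at h
        omega
      · exact MonoidAlgebra.coeff_mul_single_of_forall_mul_ne _ _ (not_exists.1 hd)
    · by_cases hd : ∃ d, FreeMonoid.of (k + 1) * d = v
      · obtain ⟨d, rfl⟩ := hd
        rw [MonoidAlgebra.coeff_single_mul_mul, one_mul]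
        by_contra hd
        have := ih d (Ne.symm hd)
        rw [FreeMonoid.length_mul, FreeMonoid.length_of] at h
        omega
      · exact (MonoidAlgebra.coeff_single_mul_of_forall_mul_ne _ _ (not_exists.1 hd)).symm

theorem IsStronglyLieNilpotent.isPIRing (h : IsStronglyLieNilpotent R) : IsPIRing R := by
  obtain ⟨k, hk⟩ := h
  refine ⟨leftNormedCommutator k, ⟨ascendingMonomial k,
    coeff_leftNormedCommutator_ascendingMonomial k, fun v hv ↦ ?_⟩, fun s ↦ ?_⟩
  · rw [length_ascendingMonomial]
    exact length_le_of_coeff_leftNormedCommutator_ne_zero k v hv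
  · rw [← TwoSidedIdeal.mem_bot, ← hk]
    exact lift_leftNormedCommutator_mem s k

end LieSeries
-- Semiprimary rings and powers of the radical.
section Semiprimary

variable {R : Type*} [Ring R]

/-- By semisimplicity, a central `z` of square zero generates the same left ideal as an idempotent e
= s z, and e = e² = s² z² = 0. -/
theorem mul_comm_quotient_jacobson (hR : IsCompletelyCentrallyEssential R)
    [IsSemisimpleRing (R ⧸ Ring.jacobson R)] (a b : R ⧸ Ring.jacobson R) : a * b = b * a := by
  refine (hR (Ring.jacobson R)).mul_comm_of_center_reduced (fun z hz hzz ↦ ?_) a b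
  obtain ⟨e, he, hspan⟩ := IsSemisimpleRing.ideal_eq_span_idempotent (Ideal.span {z})
  obtain ⟨s, hs⟩ := Ideal.mem_span_singleton'.1
    (hspan ▸ Ideal.mem_span_singleton_self e : e ∈ Ideal.span {z})
  obtain ⟨t, ht⟩ := Ideal.mem_span_singleton'.1
    (hspan ▸ Ideal.mem_span_singleton_self z : z ∈ Ideal.span {e})
  have he0 : e = 0 := by
    rw [← he.eq, ← hs, mul_assoc, ← mul_assoc z, ← hz, mul_assoc s, hzz, mul_zero, mul_zero]
  rw [← ht, he0, mul_zero]

/-- In a semiprimary completely centrally essential ring, each radical layer is central. -/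
theorem IsCompletelyCentrallyEssential.commutator_mem_jacobson_pow [IsSemiprimaryRing R]
    (hR : IsCompletelyCentrallyEssential R) (k : ℕ) {a : R} (ha : a ∈ Ring.jacobson R ^ k)
    (b : R) : a * b - b * a ∈ Ring.jacobson R ^ (k + 1) := by
  have hle : Ring.jacobson R ^ (k + 1) ≤ Ring.jacobson R := by
    rw [Submodule.pow_succ]; exact Ideal.mul_le_right
  obtain ⟨n, hn⟩ := IsSemiprimaryRing.isNilpotent (R := R)
  let f := Ideal.Quotient.factor hle
  have hker : ∀ x : R, f (Ideal.Quotient.mk _ x) = 0 → x ∈ Ring.jacobson R := fun x hx ↦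
    Ideal.Quotient.eq_zero_iff_mem.1 (by rwa [← Ideal.Quotient.factor_mk hle])
  rw [← Ideal.Quotient.eq, map_mul, map_mul, eq_comm]
  -- The kernel of `f` is J/J^(k+1). It is nil because J is nilpotent, and `a` kills it because J^k
  -- J = J^(k+1).
  refine (hR (Ring.jacobson R ^ (k + 1))).central_of_mul_ker_eq_zero
    (mul_comm_quotient_jacobson hR) f (Ideal.Quotient.factor_surjective hle) ?_ ?_ _
  · intro x hx
    obtain ⟨x, rfl⟩ := Ideal.Quotient.mk_surjective x
    refine ⟨n, ?_⟩
    have := Ideal.pow_mem_pow (hker x hx) n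
    rw [hn] at this
    rw [← map_pow, (Submodule.mem_bot R).1 this, map_zero]
  · intro x hx
    obtain ⟨x, rfl⟩ := Ideal.Quotient.mk_surjective x
    rw [← map_mul, Ideal.Quotient.eq_zero_iff_mem, Submodule.pow_succ]
    exact Ideal.mul_mem_mul ha (hker x hx)

theorem IsCompletelyCentrallyEssential.lieSeries_le_jacobson_pow [IsSemiprimaryRing R]
    (hR : IsCompletelyCentrallyEssential R) (k : ℕ) :
    lieSeries R k ≤ (Ring.jacobson R ^ k).toAddSubgroup := by
  induction k with
  | zero =>
    intro x _
    rw [Submodule.mem_toAddSubgroup, Submodule.pow_zero, Ideal.one_eq_top]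
    trivial
  | succ k ih =>
    rw [lieSeries, AddSubgroup.closure_le]
    rintro _ ⟨a, ha, b, rfl⟩
    exact hR.commutator_mem_jacobson_pow k (ih ha) b

end Semiprimary

theorem theorem1p4 {R : Type*} [Ring R] [Nontrivial R]
    (hR : IsCompletelyCentrallyEssential R) :
    (IsSemiprimaryRing R → ∀ n : ℕ, Ring.jacobson R ^ n = ⊥ →
      IsLieNilpotent R ∧ lieNilpotenceClass R ≤ n) ∧
    (IsNoetherianRing R → IsNoetherianRing Rᵐᵒᵖ →
      IsStronglyLieNilpotent R ∧ HasFiniteCentralSeries R ∧ IsPIRing R) := by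
  refine ⟨fun _ n hn ↦ ?_, fun _ _ ↦ ?_⟩
  -- The class ranges over positive integers; n = 0 would give J^0 = R = 0.
  · have hpos : 0 < n := by
      refine Nat.pos_of_ne_zero ?_
      rintro rfl
      rw [Submodule.pow_zero, Ideal.one_eq_top] at hn
      exact top_ne_bot hn
    have hbot : lieSeries R n = ⊥ := by
      refine (AddSubgroup.eq_bot_iff_forall _).2 fun x hx ↦ ?_
      have : x ∈ Ring.jacobson R ^ n := hR.lieSeries_le_jacobson_pow n hx
      rwa [hn, Submodule.mem_bot] at this
    exact ⟨⟨n, hpos, hbot⟩, Nat.sInf_le ⟨hpos, hbot⟩⟩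
  · obtain ⟨k, hk⟩ := hR.exists_strongLieSeries_le ⊥ inferInstance
    have hnil : IsStronglyLieNilpotent R := by
      refine ⟨k, le_bot_iff.1 fun x hx ↦ ?_⟩
      exact (TwoSidedIdeal.mem_bot R).2 ((Submodule.mem_bot R).1 (hk x hx))
    exact ⟨hnil, hnil.hasFiniteCentralSeries, hnil.isPIRing⟩
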